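/- **Setting.** Let $\mathbb{N}_0=\{0,1,2,\dots\}$, $\mathbb{N}=\{1,2,\dots\}$. A *directed tree* $(V,E)$ is a connected directed graph without loops and without (directed) circuits, on a nonempty countable vertex set $V$, in which every vertex $v$ has at most one parent, i.e. at most one $u$ with $(u,v)\in E$; it is *unrooted* if every vertex has a parent, denoted $\mathrm{p}(v)$. Put $\mathrm{Chi}(v)=\{u:\mathrm{p}(u)=v\}$, $\mathrm{Chi}^0(v)=\{v\}$, $\mathrm{Chi}^{n+1}(v)=\bigcup_{u\in \mathrm{Chi}(v)}\mathrm{Chi}^{n}(u)$. Let $\mathbb{K}=\mathbb{R}$ or $\mathbb{C}$ and let $\mu=(\mu_v)_{v\in V}$ be a family of nonzero scalars. For $1\le p<\infty$ let $\ell^p(V,\mu)$ be the space of $f\in\mathbb{K}^V$ with $\|f\|=(\sum_v|f(v)\mu_v|^p)^{1/p}<\infty$, and let $c_0(V,\mu)$ be the space of $f\in\mathbb{K}^V$ such that for each $\varepsilon>0$ one has $|f(v)\mu_v|<\varepsilon$ for all but finitely many $v$, with $\|f\|=\sup_v|f(v)\mu_v|$. The backward shift is $(Bf)(v)=\sum_{u\in\mathrm{Chi}(v)}f(u)$.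 A *Furstenberg family* is a nonempty family $\mathcal{F}$ of infinite subsets of $\mathbb{N}_0$ such that $A\in\mathcal{F}$ and $A\subset A'\subset\mathbb{N}_0$ imply $A'\in\mathcal{F}$. Let $\widetilde{\mathcal{F}}$ be the family of all $A\subset\mathbb{N}_0$ such that for every $N\in\mathbb{N}_0$ there is $A'\in\mathcal{F}$ with $(A'+\{-N,\dots,N\})\cap\mathbb{N}_0\subset A$. For an operator $T$ on $X$ and $U,W\subset X$ let $N(U,W)=\{n\in\mathbb{N}_0: T^n(U)\cap W\ne\emptyset\}$. For a family $\mathcal{G}$ of subsets of $\mathbb{N}_0$, $T$ is *$\mathcal{G}$-transitive* if $N(U,W)\in\mathcal{G}$ for all nonempty open $U,W\subset X$, and *topologically $\mathcal{G}$-recurrent* if $N(U,U)\in\mathcal{G}$ for all nonempty open $U\subset X$. **Theorem.** Let $(V,E)$ be an unrooted directed tree, $\mu$ a weight as above, $\mathcal{F}$ a Furstenberg family, and $X=\ell^p(V,\mu)$ with $1\le p<\infty$, or $X=c_0(V,\mu)$. Suppose that the backward shift $B$ is a bounded operator on $X$. For $1<p<\infty$ let $p^*=p/(p-1)$. The following are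 equivalent: 1. $B$ is $\widetilde{\mathcal{F}}$-transitive. 2. $B$ is $\mathcal{F}$-transitive. 3. For every $N\in\mathbb{N}$ and every finite $F\subset V$, $I(F,N)\cap J(F,N)\in\mathcal{F}$, where $I(F,N)=\bigcap_{v\in F}I_v$ and $J(F,N)=\bigcap_{v\in F}J_v$ (both equal to $\mathbb{N}_0$ if $F=\emptyset$) with $$I_v=\begin{cases}\Big\{n\in\mathbb{N}_0:\sup_{u\in\mathrm{Chi}^n(v)}\frac1{|\mu_u|}>N\Big\}& X=\ell^1(V,\mu),\\ \Big\{n\in\mathbb{N}_0:\Big(\sum_{u\in\mathrm{Chi}^n(v)}\frac1{|\mu_u|^{p^*}}\Big)^{1/p^*}>N\Big\}& X=\ell^p(V,\mu),\ 1<p<\infty,\\ \Big\{n\in\mathbb{N}_0:\sum_{u\in\mathrm{Chi}^n(v)}\frac1{|\mu_u|}>N\Big\}& X=c_0(V,\mu),\end{cases}$$ $$J_v=\begin{cases}\Big\{n\in\mathbb{N}_0:\min\Big(|\mu_{\mathrm{p}^n(v)}|,\inf_{u\in\mathrm{Chi}^n(\mathrm{p}^n(v))}|\mu_u|\Big)<\frac1N\Big\}&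 X=\ell^1(V,\mu),\\ \Big\{n\in\mathbb{N}_0:\frac1{|\mu_{\mathrm{p}^n(v)}|^{p^*}}+\sum_{u\in\mathrm{Chi}^n(\mathrm{p}^n(v))}\frac1{|\mu_u|^{p^*}}>N^{p^*}\Big\}& X=\ell^p(V,\mu),\ 1<p<\infty,\\ \Big\{n\in\mathbb{N}_0:\frac1{|\mu_{\mathrm{p}^n(v)}|}+\sum_{u\in\mathrm{Chi}^n(\mathrm{p}^n(v))}\frac1{|\mu_u|}>N\Big\}& X=c_0(V,\mu).\end{cases}$$ (A supremum or sum over the empty set is $0$.) If moreover $A\cap[n,\infty)\in\mathcal{F}$ whenever $A\in\mathcal{F}$ and $n\in\mathbb{N}$, then 1–3 are also equivalent to 4. $B$ is topologically $\mathcal{F}$-recurrent. -/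

import Mathlib

open scoped ENNReal Topology

noncomputable section

namespace TreeShift

/-! ## Directed trees -/

section Trees

variable {V : Type*}

/-- A directed tree: a loopless connected directed graph on a nonempty countable vertex set,
without (directed) circuits, in which every vertex has at most one parent. -/
structure IsDirectedTree (G : Digraph V) : Prop where
  nonempty : Nonempty V
  countable : Countable V
  loopless : ∀ v, ¬ G.Adj v v
  connected : ∀ u v, Relation.ReflTransGen (fun a b => G.Adj a b ∨ G.Adj b a) u v
  /-- Indices are taken cyclically: a circuit `c 0 → c 1 → ⋯ → c (n + 1) → c 0` consists of
  `n + 2 ≥ 2` distinct vertices. -/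
  no_circuit : ∀ (n : ℕ) (c : Fin (n + 2) → V), Function.Injective c →
    ¬ ∀ i, G.Adj (c i) (c (i + 1))
  parent_unique : ∀ u u' v, G.Adj u v → G.Adj u' v → u = u'

/-- No vertex is a root, that is, every vertex has a parent. -/
def IsUnrooted (G : Digraph V) : Prop := ∀ v, ∃ u, G.Adj u v

/-- The parent of a vertex in an unrooted directed tree. -/
def parent {G : Digraph V} (hG : IsUnrooted G) (v : V) : V := (hG v).choose

/-- The set of children of `v`. -/
def children (G : Digraph V) (v : V) : Set V := {u | G.Adj v u}

/-- `childrenN G n v` is the set of `n`-th generation descendants of `v`. -/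
def childrenN (G : Digraph V) : ℕ → V → Set V
  | 0, v => {v}
  | n + 1, v => ⋃ u ∈ children G v, childrenN G n u

end Trees

/-! ## Weighted sequence spaces

A weight is a family of nonzero scalars, that is, a function `μ : V → 𝕜ˣ`. -/

section Spaces

variable {V 𝕜 : Type*} [RCLike 𝕜]

/-- The functions `f : V → 𝕜` with `f μ ∈ ℓ^p(V)`, as a linear subspace of `𝕜^V`. -/
def lpSubmodule (μ : V → 𝕜ˣ) (p : ℝ≥0∞) : Submodule 𝕜 (V → 𝕜) where
  carrier := {f | Memℓp (fun v => f v * (μ v : 𝕜)) p}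
  zero_mem' := by
    have h : Memℓp (0 : V → 𝕜) p := zero_memℓp
    have e : (fun v => (0 : V → 𝕜) v * (μ v : 𝕜)) = 0 := by
      funext v; simp
    rw [Set.mem_ofPred_eq, e]
    exact h
  add_mem' := by
    intro f g hf hg
    have h := Memℓp.add hf hg
    have e : (fun v => (f + g) v * (μ v : 𝕜))
        = (fun v => f v * (μ v : 𝕜)) + fun v => g v * (μ v : 𝕜) := by
      funext v; simp [add_mul]
    rw [Set.mem_ofPred_eq, e]
    exact h
  smul_mem' := by
    intro c f hf
    have h := Memℓp.const_smul hf c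
    have e : (fun v => (c • f) v * (μ v : 𝕜)) = c • fun v => f v * (μ v : 𝕜) := by
      funext v; simp [mul_assoc]
    rw [Set.mem_ofPred_eq, e]
    exact h

/-- The weighted space `ℓ^p(V, μ)`. (A type of its own, so that it carries the weighted norm and
not the topology of pointwise convergence.) -/
def WeightedLp (μ : V → 𝕜ˣ) (p : ℝ≥0∞) : Type _ := ↥(lpSubmodule μ p)

/-- The functions `f : V → 𝕜` such that `f μ` tends to zero along the finite subsets of `V`, as a
linear subspace of `𝕜^V`. -/
def c0Submodule (μ : V → 𝕜ˣ) : Submodule 𝕜 (V → 𝕜) where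
  carrier := {f | ∀ ε : ℝ, 0 < ε → ∃ F : Finset V, ∀ v, v ∉ F → ‖f v * (μ v : 𝕜)‖ < ε}
  zero_mem' := by
    intro ε hε
    exact ⟨∅, fun v _ => by simpa using hε⟩
  add_mem' := by
    classical
    intro f g hf hg ε hε
    obtain ⟨A, hA⟩ := hf (ε / 2) (by positivity)
    obtain ⟨B, hB⟩ := hg (ε / 2) (by positivity)
    refine ⟨A ∪ B, fun v hv => ?_⟩
    rw [Finset.mem_union, not_or] at hv
    have h := norm_add_le (f v * (μ v : 𝕜)) (g v * (μ v : 𝕜))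
    have h1 := hA v hv.1
    have h2 := hB v hv.2
    rw [Pi.add_apply, add_mul]
    linarith
  smul_mem' := by
    intro c f hf ε hε
    obtain ⟨A, hA⟩ := hf (ε / (‖c‖ + 1)) (by positivity)
    refine ⟨A, fun v hv => ?_⟩
    have h := hA v hv
    rw [lt_div_iff₀ (by positivity)] at h
    rw [Pi.smul_apply, smul_eq_mul, mul_assoc, norm_mul]
    nlinarith [norm_nonneg (f v * (μ v : 𝕜)), norm_nonneg c]

/-- The weighted space `c_0(V, μ)`. -/
def WeightedC0 (μ : V → 𝕜ˣ) : Type _ := ↥(c0Submodule μ)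

variable (μ : V → 𝕜ˣ) (p : ℝ≥0∞)

instance : AddCommGroup (WeightedLp μ p) := inferInstanceAs (AddCommGroup ↥(lpSubmodule μ p))
instance : Module 𝕜 (WeightedLp μ p) := inferInstanceAs (Module 𝕜 ↥(lpSubmodule μ p))
instance : CoeFun (WeightedLp μ p) (fun _ => V → 𝕜) := ⟨Subtype.val⟩

instance : AddCommGroup (WeightedC0 μ) := inferInstanceAs (AddCommGroup ↥(c0Submodule μ))
instance : Module 𝕜 (WeightedC0 μ) := inferInstanceAs (Module 𝕜 ↥(c0Submodule μ))
instance : CoeFun (WeightedC0 μ) (fun _ => V → 𝕜) := ⟨Subtype.val⟩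

/-- The linear map `f ↦ f μ` from `ℓ^p(V, μ)` to the unweighted space `ℓ^p(V)`. -/
def WeightedLp.toLp : WeightedLp μ p →ₗ[𝕜] lp (fun _ : V => 𝕜) p where
  toFun f := ⟨fun v => f v * (μ v : 𝕜), f.2⟩
  map_add' f g := by
    ext v
    exact add_mul (f v) (g v) (μ v : 𝕜)
  map_smul' c f := by
    ext v
    exact mul_assoc c (f v) (μ v : 𝕜)

theorem WeightedLp.toLp_injective : Function.Injective (WeightedLp.toLp μ p) := by
  intro f g h
  apply Subtype.ext
  funext v
  have h' : f v * (μ v : 𝕜) = g v * (μ v : 𝕜) := congrFun (congrArg Subtype.val h) v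
  exact mul_right_cancel₀ (μ v).ne_zero h'

theorem c0Submodule_bounded (f : WeightedC0 μ) : Memℓp (fun v => f v * (μ v : 𝕜)) ∞ := by
  obtain ⟨A, hA⟩ := f.2 1 one_pos
  apply memℓp_infty
  refine ⟨1 + ∑ v ∈ A, ‖f v * (μ v : 𝕜)‖, ?_⟩
  rintro _ ⟨v, rfl⟩
  by_cases hv : v ∈ A
  · have h := Finset.single_le_sum (f := fun v => ‖f v * (μ v : 𝕜)‖)
      (fun i _ => norm_nonneg _) hv
    simp only at h ⊢
    linarith
  · have h := (hA v hv).le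
    have h' : 0 ≤ ∑ v ∈ A, ‖f v * (μ v : 𝕜)‖ := Finset.sum_nonneg fun i _ => norm_nonneg _
    simp only at h' ⊢
    exact le_trans h (by linarith)

/-- The linear map `f ↦ f μ` from `c_0(V, μ)` to the unweighted space `ℓ^∞(V)`. -/
def WeightedC0.toLp : WeightedC0 μ →ₗ[𝕜] lp (fun _ : V => 𝕜) ∞ where
  toFun f := ⟨fun v => f v * (μ v : 𝕜), c0Submodule_bounded μ f⟩
  map_add' f g := by
    ext v
    exact add_mul (f v) (g v) (μ v : 𝕜)
  map_smul' c f := by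
    ext v
    exact mul_assoc c (f v) (μ v : 𝕜)

theorem WeightedC0.toLp_injective : Function.Injective (WeightedC0.toLp μ) := by
  intro f g h
  apply Subtype.ext
  funext v
  have h' : f v * (μ v : 𝕜) = g v * (μ v : 𝕜) := congrFun (congrArg Subtype.val h) v
  exact mul_right_cancel₀ (μ v).ne_zero h'

/-- The norm of `ℓ^p(V, μ)`: `‖f‖` is the `ℓ^p`-norm of `f μ`. -/
instance [Fact (1 ≤ p)] : NormedAddCommGroup (WeightedLp μ p) :=
  NormedAddCommGroup.induced _ _ (WeightedLp.toLp μ p) (WeightedLp.toLp_injective μ p)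

instance [Fact (1 ≤ p)] : NormedSpace 𝕜 (WeightedLp μ p) :=
  NormedSpace.induced 𝕜 _ _ (WeightedLp.toLp μ p)

/-- The norm of `c_0(V, μ)`: `‖f‖` is the supremum norm of `f μ`. -/
instance : NormedAddCommGroup (WeightedC0 μ) :=
  NormedAddCommGroup.induced _ _ (WeightedC0.toLp μ) (WeightedC0.toLp_injective μ)

instance : NormedSpace 𝕜 (WeightedC0 μ) :=
  NormedSpace.induced 𝕜 _ _ (WeightedC0.toLp μ)

/-- `g` is the backward shift of `f`: for every vertex `v`, the sum of the values of `f` at the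
children of `v` converges, and its value is `g v`. -/
def IsBackwardShift (G : Digraph V) (f g : V → 𝕜) : Prop :=
  ∀ v, HasSum (fun u : children G v => f u) (g v)

end Spaces

/-! ## Furstenberg families and the dynamical notions -/

section Families

/-- Furstenberg families of subsets of `ℕ = {0, 1, 2, …}`. -/
structure IsFurstenberg (𝓕 : Set (Set ℕ)) : Prop where
  nonempty : 𝓕.Nonempty
  infinite : ∀ A ∈ 𝓕, A.Infinite
  upward : ∀ A ∈ 𝓕, ∀ B, A ⊆ B → B ∈ 𝓕

/-- The family of the sets `A` that contain, for every `N`, a set `(B + [-N, N]) ∩ ℕ` with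
`B ∈ 𝓕`. -/
def tildeFamily (𝓕 : Set (Set ℕ)) : Set (Set ℕ) :=
  {A | ∀ N : ℕ, ∃ B ∈ 𝓕, {n : ℕ | ∃ b ∈ B, ∃ k ∈ Set.Icc (-(N : ℤ)) N, (n : ℤ) = b + k} ⊆ A}

variable {X : Type*}

/-- The return set `N(U, W)`. -/
def returnSet (T : X → X) (U W : Set X) : Set ℕ := {n | (T^[n] '' U ∩ W).Nonempty}

variable [TopologicalSpace X]

def IsTransitive (𝓕 : Set (Set ℕ)) (T : X → X) : Prop :=
  ∀ U W : Set X, IsOpen U → IsOpen W → U.Nonempty → W.Nonempty → returnSet T U W ∈ 𝓕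

def IsTopRecurrent (𝓕 : Set (Set ℕ)) (T : X → X) : Prop :=
  ∀ U : Set X, IsOpen U → U.Nonempty → returnSet T U U ∈ 𝓕

end Families

/-! ## The weight conditions

All suprema, infima and sums are taken in `[0, ∞]`. The sets are intersected over `v ∈ F`. -/

section Conditions

variable {V 𝕜 : Type*} [RCLike 𝕜]

/-- `I(F, N)` for `ℓ^1(V, μ)`. -/
def setIOne (G : Digraph V) (μ : V → 𝕜ˣ) (F : Finset V) (N : ℕ) : Set ℕ :=
  ⋂ v ∈ F, {n : ℕ | (N : ℝ≥0∞) < ⨆ u : childrenN G n v, ‖(μ u : 𝕜)‖ₑ⁻¹}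

/-- `I(F, N)` for `ℓ^p(V, μ)`, `1 < p < ∞`, in terms of the conjugate exponent `q` of `p`. -/
def setIConj (G : Digraph V) (μ : V → 𝕜ˣ) (q : ℝ) (F : Finset V) (N : ℕ) : Set ℕ :=
  ⋂ v ∈ F, {n : ℕ | (N : ℝ≥0∞) < (∑' u : childrenN G n v, (‖(μ u : 𝕜)‖ₑ ^ q)⁻¹) ^ (1 / q)}

/-- `I(F, N)` for `c_0(V, μ)`. -/
def setIC0 (G : Digraph V) (μ : V → 𝕜ˣ) (F : Finset V) (N : ℕ) : Set ℕ :=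
  ⋂ v ∈ F, {n : ℕ | (N : ℝ≥0∞) < ∑' u : childrenN G n v, ‖(μ u : 𝕜)‖ₑ⁻¹}

variable {G : Digraph V}

/-- `J(F, N)` for `ℓ^1(V, μ)`. -/
def setJOne (hG : IsUnrooted G) (μ : V → 𝕜ˣ) (F : Finset V) (N : ℕ) : Set ℕ :=
  ⋂ v ∈ F, {n : ℕ | min ‖(μ ((parent hG)^[n] v) : 𝕜)‖ₑ
    (⨅ u : childrenN G n ((parent hG)^[n] v), ‖(μ u : 𝕜)‖ₑ) < (N : ℝ≥0∞)⁻¹}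

/-- `J(F, N)` for `ℓ^p(V, μ)`, `1 < p < ∞`, in terms of the conjugate exponent `q` of `p`. -/
def setJConj (hG : IsUnrooted G) (μ : V → 𝕜ˣ) (q : ℝ) (F : Finset V) (N : ℕ) : Set ℕ :=
  ⋂ v ∈ F, {n : ℕ | (N : ℝ≥0∞) ^ q < (‖(μ ((parent hG)^[n] v) : 𝕜)‖ₑ ^ q)⁻¹ +
    ∑' u : childrenN G n ((parent hG)^[n] v), (‖(μ u : 𝕜)‖ₑ ^ q)⁻¹}

/-- `J(F, N)` for `c_0(V, μ)`. -/
def setJC0 (hG : IsUnrooted G) (μ : V → 𝕜ˣ) (F : Finset V) (N : ℕ) : Set ℕ :=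
  ⋂ v ∈ F, {n : ℕ | (N : ℝ≥0∞) < ‖(μ ((parent hG)^[n] v) : 𝕜)‖ₑ⁻¹ +
    ∑' u : childrenN G n ((parent hG)^[n] v), ‖(μ u : 𝕜)‖ₑ⁻¹}

open Classical in
/-- `I(F, N)` for `ℓ^p(V, μ)`, `1 ≤ p < ∞`. -/
def setILp (G : Digraph V) (μ : V → 𝕜ˣ) (p : ℝ≥0∞) (F : Finset V) (N : ℕ) : Set ℕ :=
  if p = 1 then setIOne G μ F N else setIConj G μ p.toReal.conjExponent F N

open Classical in
/-- `J(F, N)` for `ℓ^p(V, μ)`, `1 ≤ p < ∞`. -/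
def setJLp (hG : IsUnrooted G) (μ : V → 𝕜ˣ) (p : ℝ≥0∞) (F : Finset V) (N : ℕ) : Set ℕ :=
  if p = 1 then setJOne hG μ F N else setJConj hG μ p.toReal.conjExponent F N

end Conditions

end TreeShift

end

open TreeShift

/-! The three spaces enter only through `CoordinateSystem`: the unit vectors `e_v` span a dense
subspace, `|μ_v|` is the norm of `e_v`, and `dual S` is the norm of the functional summing the
coordinates over `S`. Since `B e_v = e_{p(v)}`, the coordinate of `B^n x` at `v` is the sum of `x`
over `Chi^n(v)`. So a large `dual (Chi^n(v))` means exactly that `e_v = B^n x` for some small `x`,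
and the explicit conditions become `largeSet`, up to a factor 2 in `N`.

Necessity: test transitivity on small balls around `∑ e_u` and `-∑ e_u`, summing over `F`.
Coordinates of `B^n ∑ e_u` are natural numbers, so no cancellation occurs, and a return time forces
large weights (`exists_returnSet_subset_largeSet`). For recurrence both balls coincide, and one
discards the finitely many `n` for which `p^n(F)` meets `F`.

Sufficiency: large weights allow each `e_v`, and each `B^n e_v`, to be approximated by `B^n` of
small vectors (`approxSet`), and correcting a finitely supported vector by these gives transitivity.
Applying powers of `B` moves such approximations by up to `K` steps in time
(`exists_approxSet_shift`), which upgrades `𝓕` to `tildeFamily 𝓕` at no cost. -/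

namespace TreeShift

/-! ### Ancestors in an unrooted directed tree. -/

section TreeLemmas

variable {V : Type*} {G : Digraph V}

theorem adj_parent (hG : IsUnrooted G) (v : V) : G.Adj (parent hG v) v := (hG v).choose_spec

theorem adj_iff_parent_eq (hT : IsDirectedTree G) (hG : IsUnrooted G) {u v : V} :
    G.Adj u v ↔ parent hG v = u :=
  ⟨fun h => hT.parent_unique _ _ _ (adj_parent hG v) h, fun h => h ▸ adj_parent hG v⟩

theorem mem_childrenN_iff (hT : IsDirectedTree G) (hG : IsUnrooted G) {n : ℕ} {u v : V} :
    u ∈ childrenN G n v ↔ (parent hG)^[n] u = v := by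
  induction n generalizing v with
  | zero => simp [childrenN]
  | succ n ih =>
    simp only [childrenN, Set.mem_iUnion, ih, exists_prop, children, Set.mem_ofPred_eq,
      Function.iterate_succ_apply', adj_iff_parent_eq hT hG]
    exact ⟨fun ⟨w, h, h'⟩ => h' ▸ h, fun h => ⟨_, h, rfl⟩⟩

theorem iterate_parent_ne_self (hT : IsDirectedTree G) (hG : IsUnrooted G) {n : ℕ} (hn : 0 < n)
    (v : V) : (parent hG)^[n] v ≠ v := by
  intro h
  have hper : Function.IsPeriodicPt (parent hG) n v := h
  have hpos := hper.minimalPeriod_pos hn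
  obtain ⟨m, hm⟩ : ∃ m, Function.minimalPeriod (parent hG) v = m := ⟨_, rfl⟩
  have hmin : (parent hG)^[m] v = v := hm ▸ Function.iterate_minimalPeriod
  match m, hm with
  | 0, hm => omega
  | 1, hm => exact hT.loopless v ((adj_iff_parent_eq hT hG).2 hmin)
  | k + 2, hm =>
    -- Edges point from parent to child, so the orbit of `v` under `parent` is listed backwards.
    -- Exponents below the minimal period give distinct vertices.
    refine hT.no_circuit k (fun i => (parent hG)^[k + 1 - i] v) ?_ ?_
    · intro i j hij
      have h1 := Function.iterate_injOn_Iio_minimalPeriod (f := parent hG) (x := v)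
        (Set.mem_Iio.2 (by rw [hm]; omega)) (Set.mem_Iio.2 (by rw [hm]; omega)) hij
      ext
      have := i.2
      have := j.2
      omega
    · intro i
      rw [adj_iff_parent_eq hT hG]
      induction i using Fin.lastCases with
      -- The closing edge runs from `v` to its `(k+1)`-st ancestor and uses periodicity.
      | last =>
        have : (parent hG)^[k + 1 + 1] v = v := hmin
        rw [Function.iterate_succ_apply'] at this
        simpa [Fin.last_add_one] using this
      | cast i =>
        have hi := i.2
        rw [Fin.coeSucc_eq_succ]
        simp only [Fin.val_succ, Fin.val_castSucc]
        rw [← Function.iterate_succ_apply' (parent hG)]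
        congr 2
        omega

theorem iterate_parent_injective (hT : IsDirectedTree G) (hG : IsUnrooted G) (v : V) :
    Function.Injective fun n => (parent hG)^[n] v := by
  refine Function.Injective.of_lt_imp_ne fun m n hmn h => ?_
  obtain ⟨k, rfl⟩ := Nat.exists_eq_add_of_lt hmn
  refine iterate_parent_ne_self hT hG (n := k + 1) (by omega) ((parent hG)^[m] v) ?_
  rw [← Function.iterate_add_apply, show k + 1 + m = m + k + 1 by omega]
  exact h.symm

/-- The ancestors of a finite set of vertices eventually leave this set. -/
theorem exists_iterate_parent_notMem (hT : IsDirectedTree G) (hG : IsUnrooted G) (F : Finset V) :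
    ∃ n₀, ∀ n ≥ n₀, ∀ u ∈ F, (parent hG)^[n] u ∉ F := by
  have h : ∀ u ∈ F, ∀ᶠ n in Filter.atTop, (parent hG)^[n] u ∉ F := fun u _ => by
    have := (iterate_parent_injective hT hG u).tendsto_cofinite.eventually
      F.finite_toSet.compl_mem_cofinite
    rw [Nat.cofinite_eq_atTop] at this
    exact this
  exact Filter.eventually_atTop.1 ((Filter.eventually_all_finset F).2 h)

end TreeLemmas

/-! ### The backward shift in coordinates. -/

variable {V 𝕜 : Type*} [RCLike 𝕜]

open Classical in
/-- A normed space of functions on `V` in which the unit vectors form a basis with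
`‖e_v‖ = |μ_v|`; `dual S` is the norm of the functional `f ↦ ∑ u ∈ S, f u`. -/
structure CoordinateSystem (μ : V → 𝕜ˣ) (X : Type*) [NormedAddCommGroup X]
    [NormedSpace 𝕜 X] where
  coord : X →ₗ[𝕜] (V → 𝕜)
  coord_injective : Function.Injective coord
  basis : V → X
  coord_basis : ∀ v, coord (basis v) = Pi.single v 1
  norm_basis : ∀ v, ‖basis v‖ = ‖(μ v : 𝕜)‖
  norm_coord_mul_le : ∀ x v, ‖coord x v‖ * ‖(μ v : 𝕜)‖ ≤ ‖x‖
  approx : ∀ x, ∀ ε > 0, ∃ T : Finset V, ‖x - ∑ v ∈ T, coord x v • basis v‖ < ε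
  dual : Set V → ℝ≥0∞
  enorm_sum_coord_le : ∀ (S : Set V) (T : Finset V), ↑T ⊆ S → ∀ x,
    ‖∑ u ∈ T, coord x u‖ₑ ≤ dual S * ‖x‖ₑ
  exists_of_lt_dual : ∀ (S : Set V) (a : ℝ≥0∞), a < dual S → ∃ T : Finset V, ↑T ⊆ S ∧
    ∃ c : V → 𝕜, ∑ u ∈ T, c u = 1 ∧ a * ‖∑ u ∈ T, c u • basis u‖ₑ < 1

namespace CoordinateSystem

variable {μ : V → 𝕜ˣ} {X : Type*} [NormedAddCommGroup X] [NormedSpace 𝕜 X]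
  (s : CoordinateSystem μ X) {G : Digraph V} {B : X →L[𝕜] X}

theorem norm_coord_le (x : X) (v : V) : ‖s.coord x v‖ ≤ ‖(μ v : 𝕜)‖⁻¹ * ‖x‖ := by
  have h : 0 < ‖(μ v : 𝕜)‖ := norm_pos_iff.2 (μ v).ne_zero
  rw [inv_mul_eq_div, le_div_iff₀ h]
  exact s.norm_coord_mul_le x v

theorem continuous_coord (v : V) : Continuous fun x => s.coord x v := by
  let φ : X →ₗ[𝕜] 𝕜 := LinearMap.proj v ∘ₗ s.coord
  exact (LinearMap.mkContinuous φ _ (fun x => s.norm_coord_le x v)).continuous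

open Classical in
theorem coord_sum_basis (T : Finset V) (c : V → 𝕜) (v : V) :
    s.coord (∑ u ∈ T, c u • s.basis u) v = if v ∈ T then c v else 0 := by
  simp [s.coord_basis, Pi.single_apply]

theorem map_basis (hT : IsDirectedTree G) (hG : IsUnrooted G)
    (hB : ∀ x, IsBackwardShift G (s.coord x) (s.coord (B x))) (v : V) :
    B (s.basis v) = s.basis (parent hG v) := by
  classical
  apply s.coord_injective
  funext w
  refine (hB (s.basis v) w).unique ?_
  rw [s.coord_basis, s.coord_basis]
  by_cases h : parent hG v = w
  · have hv : v ∈ children G w := (adj_iff_parent_eq hT hG).2 h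
    convert hasSum_single (⟨v, hv⟩ : children G w) ?_ using 1
    · simp [h]
    · rintro ⟨u, hu⟩ hne
      exact Pi.single_eq_of_ne (fun e => hne (Subtype.ext e)) _
  · rw [Pi.single_eq_of_ne (Ne.symm h)]
    convert hasSum_zero using 1
    funext ⟨u, hu⟩
    refine Pi.single_eq_of_ne (fun e => h ?_) _
    rw [← e]
    exact (adj_iff_parent_eq hT hG).1 hu

theorem iterate_map_basis (hT : IsDirectedTree G) (hG : IsUnrooted G)
    (hB : ∀ x, IsBackwardShift G (s.coord x) (s.coord (B x))) (n : ℕ) (v : V) :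
    B^[n] (s.basis v) = s.basis ((parent hG)^[n] v) := by
  induction n with
  | zero => rfl
  | succ n ih => rw [Function.iterate_succ_apply', ih, s.map_basis hT hG hB,
      Function.iterate_succ_apply']

theorem iterate_map_sum_basis (hT : IsDirectedTree G) (hG : IsUnrooted G)
    (hB : ∀ x, IsBackwardShift G (s.coord x) (s.coord (B x))) (n : ℕ) (T : Finset V)
    (c : V → 𝕜) :
    B^[n] (∑ u ∈ T, c u • s.basis u) = ∑ u ∈ T, c u • s.basis ((parent hG)^[n] u) := by
  rw [← FunLike.coe_pow_eq_iterate, map_sum]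
  refine Finset.sum_congr rfl fun u _ => ?_
  rw [map_smul, FunLike.coe_pow_eq_iterate, s.iterate_map_basis hT hG hB]

open Classical in
theorem coord_iterate_sum_basis (hT : IsDirectedTree G) (hG : IsUnrooted G)
    (hB : ∀ x, IsBackwardShift G (s.coord x) (s.coord (B x))) (n : ℕ) (T : Finset V)
    (c : V → 𝕜) (v : V) :
    s.coord (B^[n] (∑ u ∈ T, c u • s.basis u)) v =
      ∑ u ∈ T with (parent hG)^[n] u = v, c u := by
  rw [s.iterate_map_sum_basis hT hG hB, Finset.sum_filter]
  simp [s.coord_basis, Pi.single_apply, eq_comm]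

/-- For finitely supported `x` the coordinate is a finite sum over part of `Chi^n(v)`, which `dual`
controls; density and continuity give the rest. Continuity of the right side needs a finite `dual`,
hence the two cases treated beforehand. -/
theorem enorm_coord_iterate_le (hT : IsDirectedTree G) (hG : IsUnrooted G)
    (hB : ∀ x, IsBackwardShift G (s.coord x) (s.coord (B x))) (n : ℕ) (x : X) (v : V) :
    ‖s.coord (B^[n] x) v‖ₑ ≤ s.dual (childrenN G n v) * ‖x‖ₑ := by
  classical
  by_cases hx : x = 0
  · rw [hx, ← FunLike.coe_pow_eq_iterate, map_zero, map_zero]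
    simp
  by_cases hD : s.dual (childrenN G n v) = ⊤
  · rw [hD, ENNReal.top_mul (by simpa using hx)]
    exact le_top
  have hcl : IsClosed {x | ‖s.coord (B^[n] x) v‖ₑ ≤ s.dual (childrenN G n v) * ‖x‖ₑ} :=
    isClosed_le ((s.continuous_coord v).comp (B.continuous.iterate n)).enorm
      ((ENNReal.continuous_const_mul hD).comp continuous_enorm)
  refine hcl.closure_subset (Metric.mem_closure_iff.2 fun ε hε => ?_)
  obtain ⟨T, hT'⟩ := s.approx x ε hε
  refine ⟨_, ?_, (dist_eq_norm _ _).trans_lt hT'⟩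
  rw [Set.mem_ofPred_eq, s.coord_iterate_sum_basis hT hG hB]
  have hsub : (↑{u ∈ T | (parent hG)^[n] u = v} : Set V) ⊆ childrenN G n v := fun u hu =>
    (mem_childrenN_iff hT hG).2 (Finset.mem_filter.1 hu).2
  convert s.enorm_sum_coord_le _ _ hsub (∑ u ∈ T, s.coord x u • s.basis u) using 2
  refine Finset.sum_congr rfl fun u hu => ?_
  rw [s.coord_sum_basis, if_pos (Finset.mem_filter.1 hu).1]

/-- Total mass 1 spread over `Chi^n(v)` is carried by `B^n` onto `e_v`, and a large `dual` lets this
be done with small norm. -/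
theorem exists_iterate_eq_basis (hT : IsDirectedTree G) (hG : IsUnrooted G)
    (hB : ∀ x, IsBackwardShift G (s.coord x) (s.coord (B x))) {n : ℕ} {v : V} {N : ℕ}
    (h : (N : ℝ≥0∞) < s.dual (childrenN G n v)) :
    ∃ x, B^[n] x = s.basis v ∧ N * ‖x‖ < 1 := by
  obtain ⟨T, hTS, c, hc, hN⟩ := s.exists_of_lt_dual _ _ h
  refine ⟨∑ u ∈ T, c u • s.basis u, ?_, ?_⟩
  rotate_left
  · rw [← ofReal_norm, ← ENNReal.ofReal_natCast, ← ENNReal.ofReal_mul (by positivity),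
      ENNReal.ofReal_lt_one] at hN
    exact hN
  · rw [s.iterate_map_sum_basis hT hG hB, ← one_smul 𝕜 (s.basis v), ← hc, Finset.sum_smul]
    refine Finset.sum_congr rfl fun u hu => ?_
    rw [(mem_childrenN_iff hT hG).1 (hTS hu)]

/-- The times `n` at which the weights are large, in the sense of `dual`, at all vertices of `F`. -/
def largeSet (hG : IsUnrooted G) (F : Finset V) (N : ℕ) : Set ℕ :=
  {n | ∀ v ∈ F, (N : ℝ≥0∞) < s.dual (childrenN G n v) ∧
    ((N : ℝ≥0∞) < ‖(μ ((parent hG)^[n] v) : 𝕜)‖ₑ⁻¹ ∨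
      (N : ℝ≥0∞) < s.dual (childrenN G n ((parent hG)^[n] v)))}

/-- The times `n` at which every `e_v`, `v ∈ F`, is approximated by the `n`-th iterate of a small
vector, and so is `B^n e_v`. -/
def approxSet (B : X →L[𝕜] X) (F : Finset V) (ε : ℝ) : Set ℕ :=
  {n | ∀ v ∈ F, (∃ h, ‖h‖ < ε ∧ ‖s.basis v - B^[n] h‖ < ε) ∧
    ∃ g, ‖g‖ < ε ∧ ‖B^[n] (s.basis v) - B^[n] g‖ < ε}

/-- The two alternatives in `largeSet` match two ways of approximating `B^n e_v`: either it is
itself small and 0 will do, or it is exactly `B^n` of a small vector. -/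
theorem largeSet_subset_approxSet (hT : IsDirectedTree G) (hG : IsUnrooted G)
    (hB : ∀ x, IsBackwardShift G (s.coord x) (s.coord (B x))) (F : Finset V) {ε : ℝ} {N : ℕ}
    (hε : 0 < ε) (hN : 1 ≤ N * ε) : s.largeSet hG F N ⊆ s.approxSet B F ε := by
  have key : ∀ a : ℝ, N * a < 1 → a < ε := fun a ha =>
    lt_of_mul_lt_mul_left (ha.trans_le hN) (Nat.cast_nonneg N)
  intro n hn v hv
  obtain ⟨h1, h2⟩ := hn v hv
  refine ⟨?_, ?_⟩
  · obtain ⟨x, hx, hx'⟩ := s.exists_iterate_eq_basis hT hG hB h1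
    exact ⟨x, key _ hx', by simpa [hx] using hε⟩
  · rw [s.iterate_map_basis hT hG hB]
    rcases h2 with h2 | h2
    · refine ⟨0, by simpa using hε, ?_⟩
      rw [← FunLike.coe_pow_eq_iterate, map_zero, sub_zero, s.norm_basis]
      apply key
      have hpos : 0 < ‖(μ ((parent hG)^[n] v) : 𝕜)‖ := norm_pos_iff.2 (Units.ne_zero _)
      rw [← ofReal_norm, ← ENNReal.ofReal_inv_of_pos hpos, ← ENNReal.ofReal_natCast,
        ENNReal.ofReal_lt_ofReal_iff (by positivity)] at h2
      rwa [← one_div, lt_div_iff₀ hpos] at h2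
    · obtain ⟨x, hx, hx'⟩ := s.exists_iterate_eq_basis hT hG hB h2
      exact ⟨x, key _ hx', by simpa [hx] using hε⟩

end CoordinateSystem
end TreeShift

/-! ### Necessity of the weight conditions. -/

namespace TreeShift

variable {V 𝕜 : Type*} [RCLike 𝕜]

namespace CoordinateSystem

variable {μ : V → 𝕜ˣ} {X : Type*} [NormedAddCommGroup X] [NormedSpace 𝕜 X]
  (s : CoordinateSystem μ X) {G : Digraph V} {B : X →L[𝕜] X}

/-- If `z` is close to `x` and `B^n z` is close to `y`, but `B^n x` and `y` differ at `w`, then one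
of the weights belonging to `w` is large. -/
theorem lt_dual_or_lt_inv (hT : IsDirectedTree G) (hG : IsUnrooted G)
    (hB : ∀ x, IsBackwardShift G (s.coord x) (s.coord (B x))) {n : ℕ} {x y z : X} {w : V}
    {ε M : ℝ} (hM : 0 < M) (hε : 2 * M * ε ≤ 1) (hx : ‖z - x‖ < ε) (hy : ‖B^[n] z - y‖ < ε)
    (h : 1 ≤ ‖s.coord (B^[n] x) w - s.coord y w‖) :
    ENNReal.ofReal M < s.dual (childrenN G n w) ∨ M < ‖(μ w : 𝕜)‖⁻¹ := by
  by_contra! hcon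
  obtain ⟨hD, hμ⟩ := hcon
  have h1 : ‖s.coord (B^[n] (z - x)) w‖ ≤ M * ‖z - x‖ := by
    have := (s.enorm_coord_iterate_le hT hG hB n (z - x) w).trans (mul_le_mul_left hD _)
    rw [← ofReal_norm, ← ofReal_norm, ← ENNReal.ofReal_mul hM.le] at this
    exact (ENNReal.ofReal_le_ofReal_iff (by positivity)).1 this
  have h2 : ‖s.coord (B^[n] z - y) w‖ ≤ M * ‖B^[n] z - y‖ :=
    (s.norm_coord_le _ w).trans (mul_le_mul_of_nonneg_right hμ (norm_nonneg _))
  -- Each term on the right is less than `M * ε ≤ 1/2` in norm, so the difference cannot reach 1.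
  have h3 : s.coord (B^[n] x) w - s.coord y w =
      s.coord (B^[n] z - y) w - s.coord (B^[n] (z - x)) w := by
    rw [iterate_map_sub, map_sub, map_sub, Pi.sub_apply, Pi.sub_apply]
    ring
  rw [h3] at h
  have h4 := norm_sub_le (s.coord (B^[n] z - y) w) (s.coord (B^[n] (z - x)) w)
  nlinarith

theorem exists_returnSet_subset_largeSet (hT : IsDirectedTree G) (hG : IsUnrooted G)
    (hB : ∀ x, IsBackwardShift G (s.coord x) (s.coord (B x))) (F : Finset V) (N : ℕ) :
    ∃ ε > 0, ∀ (x y : X) (n : ℕ),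
      (∀ w ∈ F, 1 ≤ ‖s.coord (B^[n] x) w - s.coord y w‖) →
      (∀ v ∈ F, 1 ≤ ‖s.coord (B^[n] x) ((parent hG)^[n] v) - s.coord y ((parent hG)^[n] v)‖) →
      n ∈ returnSet B (Metric.ball x ε) (Metric.ball y ε) → n ∈ s.largeSet hG F N := by
  have hS : 0 ≤ ∑ v ∈ F, ‖(μ v : 𝕜)‖⁻¹ := Finset.sum_nonneg fun _ _ => by positivity
  -- `M` exceeds `N` and every `|μ_v|⁻¹` with `v ∈ F`. At `v` itself only the `dual` alternative
  -- survives; at the ancestor both remain, as in `J`.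
  obtain ⟨M, hM⟩ : ∃ M : ℝ, M = N + 1 + ∑ v ∈ F, ‖(μ v : 𝕜)‖⁻¹ := ⟨_, rfl⟩
  have hM0 : 0 < M := by rw [hM]; positivity
  have hNM : (N : ℝ≥0∞) ≤ ENNReal.ofReal M := by
    rw [← ENNReal.ofReal_natCast]
    exact ENNReal.ofReal_le_ofReal (by linarith)
  refine ⟨1 / (2 * M), by positivity, fun x y n h1 h2 hn v hv => ?_⟩
  obtain ⟨_, ⟨z, hz, rfl⟩, hz'⟩ := hn
  rw [mem_ball_iff_norm] at hz hz'
  have key := fun w => s.lt_dual_or_lt_inv hT hG hB (w := w) hM0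
    (mul_one_div_cancel (by positivity : 2 * M ≠ 0)).le hz hz'
  constructor
  · refine hNM.trans_lt ((key v (h1 v hv)).resolve_right (not_lt.2 ?_))
    have := Finset.single_le_sum (f := fun v => ‖(μ v : 𝕜)‖⁻¹)
      (fun _ _ => by positivity) hv
    have hN : (0 : ℝ) ≤ N := Nat.cast_nonneg N
    linarith
  · refine (key _ (h2 v hv)).symm.imp (fun h => ?_) hNM.trans_lt
    have hpos : 0 < ‖(μ ((parent hG)^[n] v) : 𝕜)‖ := norm_pos_iff.2 (Units.ne_zero _)
    rw [← ofReal_norm, ← ENNReal.ofReal_inv_of_pos hpos]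
    exact hNM.trans_lt ((ENNReal.ofReal_lt_ofReal_iff (by positivity)).2 h)

open Classical in
theorem coord_sum_basis_one (F : Finset V) (w : V) :
    s.coord (∑ u ∈ F, s.basis u) w = if w ∈ F then 1 else 0 := by
  simpa using s.coord_sum_basis F (fun _ => 1) w

open Classical in
theorem coord_iterate_sum_basis_one (hT : IsDirectedTree G) (hG : IsUnrooted G)
    (hB : ∀ x, IsBackwardShift G (s.coord x) (s.coord (B x))) (F : Finset V) (n : ℕ) (w : V) :
    s.coord (B^[n] (∑ u ∈ F, s.basis u)) w =
      ((F.filter fun u => (parent hG)^[n] u = w).card : 𝕜) := by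
  simpa using s.coord_iterate_sum_basis hT hG hB n F (fun _ => 1) w

theorem one_le_norm_natCast {m : ℕ} (hm : 0 < m) : 1 ≤ ‖(m : 𝕜)‖ := by
  rw [RCLike.norm_natCast]
  exact_mod_cast hm

variable {𝓕 : Set (Set ℕ)}

/-- With centres `∑ e_u` and `-∑ e_u` the relevant difference of coordinates is a sum of two natural
numbers. One of them is positive at each `v ∈ F` and at each `p^n(v)`. -/
theorem largeSet_mem_of_isTransitive (hT : IsDirectedTree G) (hG : IsUnrooted G)
    (hB : ∀ x, IsBackwardShift G (s.coord x) (s.coord (B x))) (h𝓕 : IsFurstenberg 𝓕)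
    (h : IsTransitive 𝓕 B) (F : Finset V) (N : ℕ) : s.largeSet hG F N ∈ 𝓕 := by
  classical
  obtain ⟨ε, hε, H⟩ := s.exists_returnSet_subset_largeSet hT hG hB F N
  refine h𝓕.upward _ (h (Metric.ball (∑ u ∈ F, s.basis u) ε)
    (Metric.ball (-∑ u ∈ F, s.basis u) ε) Metric.isOpen_ball Metric.isOpen_ball
    (Metric.nonempty_ball.2 hε) (Metric.nonempty_ball.2 hε)) _ fun n hn => H _ _ n ?_ ?_ hn
  · intro w hw
    rw [s.coord_iterate_sum_basis_one hT hG hB, map_neg, Pi.neg_apply, s.coord_sum_basis_one,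
      if_pos hw, sub_neg_eq_add, ← Nat.cast_succ]
    exact one_le_norm_natCast (Nat.succ_pos _)
  · intro v hv
    rw [s.coord_iterate_sum_basis_one hT hG hB, map_neg, Pi.neg_apply, s.coord_sum_basis_one,
      sub_neg_eq_add]
    have hpos : 0 < (F.filter fun u => (parent hG)^[n] u = (parent hG)^[n] v).card :=
      Finset.card_pos.2 ⟨v, Finset.mem_filter.2 ⟨hv, rfl⟩⟩
    split_ifs
    · rw [← Nat.cast_succ]
      exact one_le_norm_natCast (Nat.succ_pos _)
    · rw [add_zero]
      exact one_le_norm_natCast hpos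

/-- With equal centres the counts could cancel. Past `n₀` the sets `F` and `p^n(F)` are disjoint, so
at each vertex tested only one of the two terms is nonzero. -/
theorem largeSet_mem_of_isTopRecurrent (hT : IsDirectedTree G) (hG : IsUnrooted G)
    (hB : ∀ x, IsBackwardShift G (s.coord x) (s.coord (B x))) (h𝓕 : IsFurstenberg 𝓕)
    (hcut : ∀ A ∈ 𝓕, ∀ n : ℕ, A ∩ Set.Ici n ∈ 𝓕)
    (h : IsTopRecurrent 𝓕 B) (F : Finset V) (N : ℕ) : s.largeSet hG F N ∈ 𝓕 := by
  classical
  obtain ⟨ε, hε, H⟩ := s.exists_returnSet_subset_largeSet hT hG hB F N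
  obtain ⟨n₀, hn₀⟩ := exists_iterate_parent_notMem hT hG F
  refine h𝓕.upward _ (hcut _ (h (Metric.ball (∑ u ∈ F, s.basis u) ε) Metric.isOpen_ball
    (Metric.nonempty_ball.2 hε)) n₀) _ fun n hn => H _ _ n ?_ ?_ hn.1
  · intro w hw
    rw [s.coord_iterate_sum_basis_one hT hG hB, s.coord_sum_basis_one, if_pos hw,
      Finset.filter_eq_empty_iff.2 fun u hu (hw' : _ = w) =>
        hn₀ n hn.2 u hu (by rwa [hw'])]
    simp
  · intro v hv
    rw [s.coord_iterate_sum_basis_one hT hG hB, s.coord_sum_basis_one, if_neg (hn₀ n hn.2 v hv),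
      sub_zero]
    exact one_le_norm_natCast (Finset.card_pos.2 ⟨v, Finset.mem_filter.2 ⟨hv, rfl⟩⟩)

/-! ### Sufficiency: from approximation to transitivity. -/

theorem exists_approxSet_subset_returnSet {U W : Set X} (hU : IsOpen U) (hW : IsOpen W)
    (hU' : U.Nonempty) (hW' : W.Nonempty) :
    ∃ (F : Finset V) (ε : ℝ), 0 < ε ∧ s.approxSet B F ε ⊆ returnSet B U W := by
  classical
  obtain ⟨x, hx⟩ := hU'
  obtain ⟨y, hy⟩ := hW'
  obtain ⟨δ, hδ, hxδ⟩ := Metric.isOpen_iff.1 hU x hx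
  obtain ⟨δ', hδ', hyδ⟩ := Metric.isOpen_iff.1 hW y hy
  obtain ⟨S, hS⟩ := s.approx x (δ / 2) (by positivity)
  obtain ⟨T, hT⟩ := s.approx y (δ' / 2) (by positivity)
  -- `K` bounds the total size of the coefficients, so errors below `ε` in each basis vector add up
  -- to at most `K * ε`.
  obtain ⟨K, hK⟩ : ∃ K : ℝ, K = ∑ v ∈ S, ‖s.coord x v‖ + ∑ v ∈ T, ‖s.coord y v‖ := ⟨_, rfl⟩
  have hK0 : 0 ≤ K := by rw [hK]; positivity
  have hη : 0 < min (δ / 2) (δ' / 2) := by positivity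
  obtain ⟨ε, hε, hKε⟩ : ∃ ε : ℝ, 0 < ε ∧ K * ε ≤ min (δ / 2) (δ' / 2) := by
    refine ⟨min (δ / 2) (δ' / 2) / (K + 1), by positivity, ?_⟩
    rw [← mul_div_assoc, div_le_iff₀ (by positivity)]
    nlinarith
  refine ⟨S ∪ T, ε, hε, fun n hn => ?_⟩
  have hn1 : ∀ v, ∃ g, v ∈ S → ‖g‖ < ε ∧ ‖B^[n] (s.basis v) - B^[n] g‖ < ε := fun v => by
    by_cases hv : v ∈ S
    · obtain ⟨g, hg⟩ := (hn v (Finset.mem_union_left _ hv)).2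
      exact ⟨g, fun _ => hg⟩
    · exact ⟨0, fun h => absurd h hv⟩
  have hn2 : ∀ v, ∃ h, v ∈ T → ‖h‖ < ε ∧ ‖s.basis v - B^[n] h‖ < ε := fun v => by
    by_cases hv : v ∈ T
    · obtain ⟨g, hg⟩ := (hn v (Finset.mem_union_right _ hv)).1
      exact ⟨g, fun _ => hg⟩
    · exact ⟨0, fun h => absurd h hv⟩
  choose g hg using hn1
  choose h hh using hn2
  have bound : ∀ a b : V → X, (∀ v ∈ S, ‖a v‖ < ε) → (∀ v ∈ T, ‖b v‖ < ε) →
      ‖∑ v ∈ S, s.coord x v • a v - ∑ v ∈ T, s.coord y v • b v‖ ≤ min (δ / 2) (δ' / 2) := by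
    intro a b ha hb
    refine (norm_sub_le _ _).trans (le_trans ?_ hKε)
    rw [hK, add_mul, Finset.sum_mul, Finset.sum_mul]
    refine add_le_add (norm_sum_le_of_le _ fun v hv => ?_) (norm_sum_le_of_le _ fun v hv => ?_)
    · rw [norm_smul]
      exact mul_le_mul_of_nonneg_left (ha v hv).le (norm_nonneg _)
    · rw [norm_smul]
      exact mul_le_mul_of_nonneg_left (hb v hv).le (norm_nonneg _)
  -- Subtracting the `g v` almost cancels `B^n` of the truncated `x`, and adding the `h v` produces
  -- the truncated `y`. Both corrections are small before `B^n` is applied.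
  let z := ∑ v ∈ S, s.coord x v • s.basis v -
    (∑ v ∈ S, s.coord x v • g v - ∑ v ∈ T, s.coord y v • h v)
  have hz : B^[n] z = ∑ v ∈ T, s.coord y v • s.basis v +
      (∑ v ∈ S, s.coord x v • (B^[n] (s.basis v) - B^[n] (g v)) -
        ∑ v ∈ T, s.coord y v • (s.basis v - B^[n] (h v))) := by
    simp only [z, ← FunLike.coe_pow_eq_iterate, map_sub, map_sum, map_smul, smul_sub,
      Finset.sum_sub_distrib]
    abel
  refine ⟨B^[n] z, ⟨z, hxδ ?_, rfl⟩, hyδ ?_⟩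
  · rw [mem_ball_iff_norm, norm_sub_rev]
    have h1 := bound g h (fun v hv => (hg v hv).1) (fun v hv => (hh v hv).1)
    have h2 := norm_add_le (x - ∑ v ∈ S, s.coord x v • s.basis v)
      (∑ v ∈ S, s.coord x v • g v - ∑ v ∈ T, s.coord y v • h v)
    have h3 := min_le_left (δ / 2) (δ' / 2)
    rw [show x - z = (x - ∑ v ∈ S, s.coord x v • s.basis v) +
      (∑ v ∈ S, s.coord x v • g v - ∑ v ∈ T, s.coord y v • h v) by simp only [z]; abel]
    linarith
  · rw [mem_ball_iff_norm, norm_sub_rev, hz, ← sub_sub]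
    have h1 := bound _ _ (fun v hv => (hg v hv).2) (fun v hv => (hh v hv).2)
    have h2 := min_le_right (δ / 2) (δ' / 2)
    refine (norm_sub_le _ _).trans_lt ?_
    linarith

/-- At a childless `v` every vector `B^n x` with `n > 0` vanishes, so `e_v` stays at distance at
least `|μ_v|` from it. Infinite members of `𝓕` supply such an `n`. -/
theorem parent_surjective_of_approxSet_mem (hT : IsDirectedTree G) (hG : IsUnrooted G)
    (hB : ∀ x, IsBackwardShift G (s.coord x) (s.coord (B x))) (h𝓕 : IsFurstenberg 𝓕)
    (h : ∀ F, ∀ ε > 0, s.approxSet B F ε ∈ 𝓕) : Function.Surjective (parent hG) := by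
  classical
  intro v
  by_contra! hv
  have hpos : 0 < ‖(μ v : 𝕜)‖ := norm_pos_iff.2 (Units.ne_zero _)
  obtain ⟨n, hn, hn0⟩ := (h𝓕.infinite _ (h {v} _ hpos)).exists_gt 0
  obtain ⟨x, -, hx⟩ := (hn v (Finset.mem_singleton_self v)).1
  obtain ⟨m, rfl⟩ := Nat.exists_eq_succ_of_ne_zero hn0.ne'
  have : IsEmpty (children G v) :=
    ⟨fun u => hv u ((adj_iff_parent_eq hT hG).1 u.2)⟩
  have h0 : s.coord (B^[m + 1] x) v = 0 := by
    rw [Function.iterate_succ_apply']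
    exact (hB (B^[m] x) v).unique hasSum_empty
  have h1 := s.norm_coord_mul_le (s.basis v - B^[m + 1] x) v
  rw [map_sub, Pi.sub_apply, h0, s.coord_basis, Pi.single_eq_same, sub_zero, norm_one,
    one_mul] at h1
  exact absurd hx (not_lt.2 h1)

theorem norm_iterate_le (B : X →L[𝕜] X) (k : ℕ) (x : X) :
    ‖B^[k] x‖ ≤ (max 1 ‖B‖) ^ k * ‖x‖ := by
  induction k with
  | zero => simp
  | succ k ih =>
    rw [Function.iterate_succ_apply', pow_succ', mul_assoc]
    exact (B.le_of_opNorm_le (le_max_right _ _) _).trans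
      (mul_le_mul_of_nonneg_left ih (by positivity))

/-- Approximation sets contain thickenings of approximation sets. -/
theorem exists_approxSet_shift (hT : IsDirectedTree G) (hG : IsUnrooted G)
    (hB : ∀ x, IsBackwardShift G (s.coord x) (s.coord (B x)))
    (hsurj : Function.Surjective (parent hG)) (F : Finset V) {ε : ℝ} (hε : 0 < ε) (K : ℕ) :
    ∃ (F' : Finset V) (ε' : ℝ), 0 < ε' ∧ ∀ n k : ℕ, k ≤ K →
      (n ∈ s.approxSet B F' ε' → n + k ∈ s.approxSet B F ε) ∧
      (n + k ∈ s.approxSet B F' ε' → n ∈ s.approxSet B F ε) := by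
  classical
  -- `d k v` is a chosen `k`-th generation descendant of `v`, so `B^k` sends its basis vector to
  -- `e_v`.
  choose d hd using fun k => hsurj.iterate k
  obtain ⟨C, hC⟩ : ∃ C : ℝ, C = max 1 ‖B‖ := ⟨_, rfl⟩
  have hC1 : 1 ≤ C := hC ▸ le_max_left _ _
  have hCK : 1 ≤ C ^ K := one_le_pow₀ hC1
  have small : ∀ k ≤ K, ∀ x : X, ‖x‖ < ε / C ^ K → ‖B^[k] x‖ < ε := fun k hk x hx => by
    refine (norm_iterate_le B k x).trans_lt ?_
    rw [← hC]
    refine (mul_le_mul_of_nonneg_right (pow_le_pow_right₀ hC1 hk) (norm_nonneg x)).trans_lt ?_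
    rwa [lt_div_iff₀' (by positivity)] at hx
  have hbasis : ∀ k v, B^[k] (s.basis (d k v)) = s.basis v := fun k v => by
    rw [s.iterate_map_basis hT hG hB, hd]
  refine ⟨F ∪ (Finset.range (K + 1) ×ˢ F).image fun q => d q.1 q.2, ε / C ^ K, by positivity,
    fun n k hk => ?_⟩
  have hF : ∀ v ∈ F, v ∈ F ∪ (Finset.range (K + 1) ×ˢ F).image fun q => d q.1 q.2 :=
    fun v hv => Finset.mem_union_left _ hv
  have hdF : ∀ v ∈ F, d k v ∈ F ∪ (Finset.range (K + 1) ×ˢ F).image fun q => d q.1 q.2 :=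
    fun v hv => Finset.mem_union_right _ (Finset.mem_image.2 ⟨(k, v), Finset.mem_product.2
      ⟨Finset.mem_range.2 (Nat.lt_succ_of_le hk), hv⟩, rfl⟩)
  have hle : ε / C ^ K ≤ ε := div_le_self hε.le hCK
  constructor
  -- Forward in time: `B^k` is applied to the errors and the small vectors are kept.
  · intro hn v hv
    obtain ⟨x, hx, hx'⟩ := (hn _ (hdF v hv)).1
    obtain ⟨y, hy, hy'⟩ := (hn _ (hF v hv)).2
    refine ⟨⟨x, hx.trans_le hle, ?_⟩, y, hy.trans_le hle, ?_⟩
    · have := small k hk _ hx'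
      rwa [iterate_map_sub, hbasis, ← Function.iterate_add_apply, add_comm k] at this
    · have := small k hk _ hy'
      rwa [iterate_map_sub, ← Function.iterate_add_apply, ← Function.iterate_add_apply,
        add_comm k] at this
  -- Backward in time: `B^k` is absorbed into the small vectors. For the second approximation,
  -- `B^(n+k)` of the descendant's basis vector is `B^n e_v`.
  · intro hn v hv
    obtain ⟨x, hx, hx'⟩ := (hn _ (hF v hv)).1
    obtain ⟨y, hy, hy'⟩ := (hn _ (hdF v hv)).2
    refine ⟨⟨B^[k] x, small k hk x hx, ?_⟩, B^[k] y, small k hk y hy, ?_⟩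
    · rw [← Function.iterate_add_apply]
      exact hx'.trans_le hle
    · rw [Function.iterate_add_apply, hbasis, Function.iterate_add_apply] at hy'
      exact hy'.trans_le hle

theorem isTransitive_tildeFamily (hT : IsDirectedTree G) (hG : IsUnrooted G)
    (hB : ∀ x, IsBackwardShift G (s.coord x) (s.coord (B x))) (h𝓕 : IsFurstenberg 𝓕)
    (h : ∀ F, ∀ ε > 0, s.approxSet B F ε ∈ 𝓕) : IsTransitive (tildeFamily 𝓕) B := by
  intro U W hU hW hU' hW' K
  obtain ⟨F, ε, hε, hF⟩ := s.exists_approxSet_subset_returnSet (B := B) hU hW hU' hW'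
  obtain ⟨F', ε', hε', hF'⟩ := s.exists_approxSet_shift hT hG hB
    (s.parent_surjective_of_approxSet_mem hT hG hB h𝓕 h) F hε K
  refine ⟨_, h F' ε' hε', fun n ⟨b, hb, k, ⟨hk1, hk2⟩, hn⟩ => hF ?_⟩
  obtain ⟨j, rfl | rfl⟩ := k.eq_nat_or_neg
  · obtain rfl : n = b + j := by omega
    exact (hF' b j (by omega)).1 hb
  · obtain rfl : b = n + j := by omega
    exact (hF' n j (by omega)).2 hb

/-- `A N F` stands for the explicit set `I ∩ J`. Being sandwiched between large sets up to a factor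
2 suffices, as `N` is arbitrary. -/
theorem tfae (hT : IsDirectedTree G) (hG : IsUnrooted G)
    (hB : ∀ x, IsBackwardShift G (s.coord x) (s.coord (B x))) (h𝓕 : IsFurstenberg 𝓕)
    (A : ℕ → Finset V → Set ℕ) (hA : ∀ N, 0 < N → ∀ F, s.largeSet hG F N ⊆ A N F)
    (hA' : ∀ N F, A (2 * N) F ⊆ s.largeSet hG F N) :
    List.TFAE [IsTransitive (tildeFamily 𝓕) B, IsTransitive 𝓕 B,
        ∀ N : ℕ, 0 < N → ∀ F : Finset V, A N F ∈ 𝓕] ∧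
      ((∀ A ∈ 𝓕, ∀ n : ℕ, A ∩ Set.Ici n ∈ 𝓕) →
        List.TFAE [IsTransitive (tildeFamily 𝓕) B, IsTransitive 𝓕 B,
          ∀ N : ℕ, 0 < N → ∀ F : Finset V, A N F ∈ 𝓕, IsTopRecurrent 𝓕 B]) := by
  have h12 : IsTransitive (tildeFamily 𝓕) B → IsTransitive 𝓕 B := by
    intro h U W hU hW hU' hW'
    obtain ⟨A, hA, hsub⟩ := h U W hU hW hU' hW' 0
    exact h𝓕.upward A hA _ fun n hn => hsub ⟨n, hn, 0, by simp, by simp⟩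
  have h23 : IsTransitive 𝓕 B → ∀ N : ℕ, 0 < N → ∀ F : Finset V, A N F ∈ 𝓕 := fun h N hN F =>
    h𝓕.upward _ (s.largeSet_mem_of_isTransitive hT hG hB h𝓕 h F N) _ (hA N hN F)
  have h31 : (∀ N : ℕ, 0 < N → ∀ F : Finset V, A N F ∈ 𝓕) → IsTransitive (tildeFamily 𝓕) B := by
    refine fun h => s.isTransitive_tildeFamily hT hG hB h𝓕 fun F ε hε => ?_
    obtain ⟨N, hN⟩ := exists_nat_ge (1 / ε)
    rw [div_le_iff₀ hε] at hN
    have hN0 : 0 < N := Nat.pos_of_ne_zero fun h0 => by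
      rw [h0] at hN
      norm_num at hN
    exact h𝓕.upward _ (h (2 * N) (by omega) F) _
      ((hA' N F).trans (s.largeSet_subset_approxSet hT hG hB F hε hN))
  refine ⟨?_, fun hcut => ?_⟩
  · tfae_have 1 → 2 := h12
    tfae_have 2 → 3 := h23
    tfae_have 3 → 1 := h31
    tfae_finish
  · tfae_have 1 → 2 := h12
    tfae_have 2 → 3 := h23
    tfae_have 3 → 1 := h31
    tfae_have 2 → 4 := fun h U hU hU' => h U U hU hU hU' hU'
    tfae_have 4 → 3 := fun h N hN F => h𝓕.upward _
      (s.largeSet_mem_of_isTopRecurrent hT hG hB h𝓕 hcut h F N) _ (hA N hN F)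
    tfae_finish

end CoordinateSystem
end TreeShift

/-! ### Finite sums and the norms of the summation functionals. -/

namespace TreeShift

section Sums

variable {V : Type*} (S : Set V) (g : V → ℝ≥0∞)

theorem sum_le_tsum_subtype {T : Finset V} (hT : ↑T ⊆ S) : ∑ u ∈ T, g u ≤ ∑' u : S, g u := by
  rw [tsum_subtype]
  refine le_trans (Finset.sum_le_sum fun u hu => ?_) (ENNReal.sum_le_tsum T)
  rw [Set.indicator_of_mem (hT hu)]

theorem exists_finset_lt_sum {a : ℝ≥0∞} (h : a < ∑' u : S, g u) :
    ∃ T : Finset V, ↑T ⊆ S ∧ a < ∑ u ∈ T, g u := by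
  rw [ENNReal.tsum_eq_iSup_sum, lt_iSup_iff] at h
  obtain ⟨T, hT⟩ := h
  refine ⟨T.map (Function.Embedding.subtype _), fun u hu => ?_, by simpa using hT⟩
  obtain ⟨w, -, rfl⟩ := Finset.mem_map.1 hu
  exact w.2

theorem mul_enorm_lt_one {X : Type*} [NormedAddCommGroup X] {a : ℝ≥0∞} {A : ℝ} {x : X}
    (hA : 0 < A) (ha : a < ENNReal.ofReal A) (hx : ‖x‖ ≤ A⁻¹) : a * ‖x‖ₑ < 1 := by
  have h : ‖x‖ₑ ≤ (ENNReal.ofReal A)⁻¹ := by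
    rw [← ofReal_norm, ← ENNReal.ofReal_inv_of_pos hA]
    exact ENNReal.ofReal_le_ofReal hx
  refine (mul_le_mul_right h a).trans_lt ?_
  rw [← div_eq_mul_inv]
  exact ENNReal.div_lt_of_lt_mul (by rwa [one_mul])

end Sums

variable {V 𝕜 : Type*} [RCLike 𝕜] (μ : V → 𝕜ˣ)

theorem norm_unit_pos (v : V) : 0 < ‖(μ v : 𝕜)‖ := norm_pos_iff.2 (μ v).ne_zero

theorem enorm_eq_mul_inv (x : 𝕜) (v : V) :
    ‖x‖ₑ = ‖x * (μ v : 𝕜)‖ₑ * ‖(μ v : 𝕜)‖ₑ⁻¹ := by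
  rw [enorm_mul, mul_assoc, ENNReal.mul_inv_cancel (by simp) (by simp), mul_one]

/-! ### The spaces `ℓ^p(V, μ)`. -/

namespace WeightedLp

variable {μ} {p : ℝ≥0∞}

open Classical in
/-- The unit vector `e_v` of `ℓ^p(V, μ)`. -/
noncomputable def unit (μ : V → 𝕜ˣ) (p : ℝ≥0∞) (v : V) : WeightedLp μ p :=
  ⟨Pi.single v 1, by
    have h : (fun u => (Pi.single v 1 : V → 𝕜) u * (μ u : 𝕜)) = Pi.single v (μ v : 𝕜) := by
      funext u
      by_cases h : u = v
      · subst h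
        simp
      · simp [h]
    change Memℓp (fun u => (Pi.single v 1 : V → 𝕜) u * (μ u : 𝕜)) p
    rw [h]
    exact lp.memℓp (lp.single (E := fun _ : V => 𝕜) p v (μ v : 𝕜))⟩

open Classical in
theorem toLp_unit (v : V) : toLp μ p (unit μ p v) = lp.single p v (μ v : 𝕜) := by
  ext u
  change (Pi.single v 1 : V → 𝕜) u * (μ u : 𝕜) = (Pi.single v (μ v : 𝕜) : V → 𝕜) u
  by_cases h : u = v
  · subst h
    simp
  · simp [h]

/-- The inclusion of `ℓ^p(V, μ)` into `𝕜^V`. -/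
def coordMap (μ : V → 𝕜ˣ) (p : ℝ≥0∞) : WeightedLp μ p →ₗ[𝕜] (V → 𝕜) :=
  (lpSubmodule μ p).subtype

open Classical in
theorem toLp_sum_smul_unit (T : Finset V) (c : V → 𝕜) :
    toLp μ p (∑ v ∈ T, c v • unit μ p v) = ∑ v ∈ T, lp.single p v (c v * (μ v : 𝕜)) := by
  rw [map_sum]
  refine Finset.sum_congr rfl fun v _ => ?_
  rw [map_smul, toLp_unit, ← lp.single_smul, smul_eq_mul]

variable [Fact (1 ≤ p)]

theorem norm_toLp (x : WeightedLp μ p) : ‖toLp μ p x‖ = ‖x‖ := rfl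

theorem sum_enorm_rpow_le (hp : p ≠ ∞) (x : WeightedLp μ p) (T : Finset V) :
    ∑ u ∈ T, ‖x u * (μ u : 𝕜)‖ₑ ^ p.toReal ≤ ‖x‖ₑ ^ p.toReal := by
  have hp0 : 0 < p.toReal :=
    ENNReal.toReal_pos (zero_lt_one.trans_le (Fact.out : 1 ≤ p)).ne' hp
  have h := lp.sum_rpow_le_norm_rpow hp0 (toLp μ p x) T
  rw [norm_toLp] at h
  have h' := ENNReal.ofReal_le_ofReal h
  rw [ENNReal.ofReal_sum_of_nonneg fun _ _ => by positivity,
    ← ENNReal.ofReal_rpow_of_nonneg (norm_nonneg _) hp0.le, ofReal_norm] at h'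
  refine le_trans (le_of_eq (Finset.sum_congr rfl fun u _ => ?_)) h'
  rw [← ENNReal.ofReal_rpow_of_nonneg (norm_nonneg _) hp0.le, ofReal_norm]
  rfl

/-- The coordinates of `ℓ^p(V, μ)`, given the norms of the functionals `f ↦ ∑ u ∈ S, f u`. -/
noncomputable def coordinateSystem (hp : p ≠ ∞) (dual : Set V → ℝ≥0∞)
    (h1 : ∀ (S : Set V) (T : Finset V), ↑T ⊆ S → ∀ x : WeightedLp μ p,
      ‖∑ u ∈ T, x u‖ₑ ≤ dual S * ‖x‖ₑ)
    (h2 : ∀ (S : Set V) (a : ℝ≥0∞), a < dual S → ∃ T : Finset V, ↑T ⊆ S ∧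
      ∃ c : V → 𝕜, ∑ u ∈ T, c u = 1 ∧ a * ‖∑ u ∈ T, c u • unit μ p u‖ₑ < 1) :
    CoordinateSystem μ (WeightedLp μ p) where
  coord := coordMap μ p
  coord_injective := Subtype.val_injective
  basis := unit μ p
  coord_basis _ := rfl
  norm_basis v := by
    classical
    rw [← norm_toLp, toLp_unit, lp.norm_single (zero_lt_one.trans_le Fact.out)]
  norm_coord_mul_le x v := by
    have := lp.norm_apply_le_norm (zero_lt_one.trans_le (Fact.out : 1 ≤ p)).ne' (toLp μ p x) v
    rw [← norm_mul]
    exact this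
  approx x ε hε := by
    classical
    obtain ⟨T, hT⟩ := ((Metric.tendsto_nhds.1 (lp.hasSum_single hp (toLp μ p x))) ε hε).exists
    refine ⟨T, ?_⟩
    rw [dist_comm, dist_eq_norm] at hT
    rw [← norm_toLp, map_sub]
    refine lt_of_eq_of_lt ?_ hT
    rw [toLp_sum_smul_unit]
    rfl
  dual := dual
  enorm_sum_coord_le := h1
  exists_of_lt_dual := h2

theorem enorm_sum_le_iSup (S : Set V) (T : Finset V) (hT : ↑T ⊆ S) (x : WeightedLp μ 1) :
    ‖∑ u ∈ T, x u‖ₑ ≤ (⨆ u : S, ‖(μ u : 𝕜)‖ₑ⁻¹) * ‖x‖ₑ := by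
  have h := sum_enorm_rpow_le ENNReal.one_ne_top x T
  simp only [ENNReal.toReal_one, ENNReal.rpow_one] at h
  refine (enorm_sum_le _ _).trans (le_trans ?_ (mul_le_mul_right h _))
  rw [Finset.mul_sum]
  refine Finset.sum_le_sum fun u hu => ?_
  rw [enorm_eq_mul_inv μ (x u) u, mul_comm]
  exact mul_le_mul_left (le_iSup (fun u : S => ‖(μ u : 𝕜)‖ₑ⁻¹) ⟨u, hT hu⟩) _

/-- For `p = 1` a single vertex whose inverse weight exceeds `a` is enough. -/
theorem exists_of_lt_iSup (S : Set V) (a : ℝ≥0∞) (h : a < ⨆ u : S, ‖(μ u : 𝕜)‖ₑ⁻¹) :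
    ∃ T : Finset V, ↑T ⊆ S ∧ ∃ c : V → 𝕜, ∑ u ∈ T, c u = 1 ∧
      a * ‖∑ u ∈ T, c u • unit μ 1 u‖ₑ < 1 := by
  classical
  obtain ⟨u, hu⟩ := lt_iSup_iff.1 h
  refine ⟨{u.1}, by simp, fun _ => 1, by simp, ?_⟩
  have hpos := norm_unit_pos μ u
  refine mul_enorm_lt_one (A := ‖(μ u : 𝕜)‖⁻¹) (by positivity) ?_ ?_
  · rwa [ENNReal.ofReal_inv_of_pos hpos, ofReal_norm]
  · rw [Finset.sum_singleton, one_smul, inv_inv, ← norm_toLp, toLp_unit,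
      lp.norm_single zero_lt_one]

theorem enorm_sum_le_rpow {q : ℝ} (hp : p ≠ ∞) (hpq : p.toReal.HolderConjugate q) (S : Set V)
    (T : Finset V) (hT : ↑T ⊆ S) (x : WeightedLp μ p) :
    ‖∑ u ∈ T, x u‖ₑ ≤ (∑' u : S, (‖(μ u : 𝕜)‖ₑ ^ q)⁻¹) ^ (1 / q) * ‖x‖ₑ := by
  have hq := hpq.symm.pos
  refine (enorm_sum_le _ _).trans ?_
  rw [Finset.sum_congr rfl fun u _ => enorm_eq_mul_inv μ (x u) u, mul_comm]
  refine (ENNReal.inner_le_Lp_mul_Lq T _ _ hpq).trans ?_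
  gcongr
  · rw [one_div, ENNReal.rpow_inv_le_iff hpq.pos]
    exact sum_enorm_rpow_le hp x T
  · simp only [ENNReal.inv_rpow]
    exact sum_le_tsum_subtype S (fun u => (‖(μ u : 𝕜)‖ₑ ^ q)⁻¹) hT

/-- The equality case of Hölder: coefficients proportional to `|μ_u|^(-q)`, normalised to sum 1. -/
theorem exists_of_lt_rpow {q : ℝ} (hpq : p.toReal.HolderConjugate q) (S : Set V)
    (a : ℝ≥0∞) (h : a < (∑' u : S, (‖(μ u : 𝕜)‖ₑ ^ q)⁻¹) ^ (1 / q)) :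
    ∃ T : Finset V, ↑T ⊆ S ∧ ∃ c : V → 𝕜, ∑ u ∈ T, c u = 1 ∧
      a * ‖∑ u ∈ T, c u • unit μ p u‖ₑ < 1 := by
  classical
  have hq := hpq.symm.pos
  have hp := hpq.pos
  rw [one_div, ENNReal.lt_rpow_inv_iff hq] at h
  obtain ⟨T, hTS, hT⟩ := exists_finset_lt_sum S (fun u => (‖(μ u : 𝕜)‖ₑ ^ q)⁻¹) h
  let r : V → ℝ := fun u => (‖(μ u : 𝕜)‖ ^ q)⁻¹
  have hr : ∀ u, 0 < r u := fun u =>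
    inv_pos.2 (Real.rpow_pos_of_pos (norm_unit_pos μ u) q)
  have hofReal : ∑ u ∈ T, (‖(μ u : 𝕜)‖ₑ ^ q)⁻¹ = ENNReal.ofReal (∑ u ∈ T, r u) := by
    rw [ENNReal.ofReal_sum_of_nonneg fun u _ => (hr u).le]
    refine Finset.sum_congr rfl fun u _ => ?_
    rw [ENNReal.ofReal_inv_of_pos (Real.rpow_pos_of_pos (norm_unit_pos μ u) q),
      ← ENNReal.ofReal_rpow_of_pos (norm_unit_pos μ u), ofReal_norm]
  rw [hofReal] at hT
  obtain ⟨R, hR⟩ : ∃ R, R = ∑ u ∈ T, r u := ⟨_, rfl⟩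
  rw [← hR] at hT
  have hR0 : 0 < R := ENNReal.ofReal_pos.1 (zero_le.trans_lt hT)
  refine ⟨T, hTS, fun u => ((r u / R : ℝ) : 𝕜), ?_, ?_⟩
  · rw [← RCLike.ofReal_sum, ← Finset.sum_div, ← hR, div_self hR0.ne', RCLike.ofReal_one]
  refine mul_enorm_lt_one (A := R ^ (1 / q)) (by positivity) ?_ ?_
  · rwa [← ENNReal.ofReal_rpow_of_pos hR0, one_div, ENNReal.lt_rpow_inv_iff hq]
  · rw [← norm_toLp, toLp_sum_smul_unit]
    refine le_of_eq ?_
    -- Since `(1 - q) p = -q`, the `p`-th powers are again proportional to `r u`. The norm is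
    -- therefore `R^(1/p - 1) = R^(-1/q)`.
    have key : ∀ u, ‖((r u / R : ℝ) : 𝕜) * (μ u : 𝕜)‖ ^ p.toReal = r u / R ^ p.toReal := by
      intro u
      have hm := norm_unit_pos μ u
      rw [norm_mul, RCLike.norm_ofReal, abs_of_pos (div_pos (hr u) hR0), div_mul_eq_mul_div,
        Real.div_rpow (by have := hr u; positivity) hR0.le]
      congr 1
      simp only [r]
      rw [← Real.rpow_neg hm.le, ← Real.rpow_add_one hm.ne', ← Real.rpow_mul hm.le]
      congr 1
      have := hpq.mul_eq_add
      linarith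
    have hnorm := lp.norm_sum_single (E := fun _ : V => 𝕜) hp
      (fun u => ((r u / R : ℝ) : 𝕜) * (μ u : 𝕜)) T
    rw [Finset.sum_congr rfl fun u _ => key u, ← Finset.sum_div, ← hR] at hnorm
    rw [← Real.rpow_left_inj (norm_nonneg _) (by positivity) hp.ne', hnorm,
      ← Real.rpow_neg hR0.le, ← Real.rpow_mul hR0.le, ← Real.rpow_one_sub' hR0.le (by
        have := hpq.lt
        linarith)]
    congr 1
    have := hpq.inv_add_inv_eq_one
    have h3 : q⁻¹ = 1 - p.toReal⁻¹ := by linarith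
    rw [one_div, h3]
    field_simp
    ring

/-- The coordinates of `ℓ^1(V, μ)`. -/
noncomputable def coordinateSystemOne (μ : V → 𝕜ˣ) : CoordinateSystem μ (WeightedLp μ 1) :=
  coordinateSystem ENNReal.one_ne_top (fun S => ⨆ u : S, ‖(μ u : 𝕜)‖ₑ⁻¹) enorm_sum_le_iSup
    exists_of_lt_iSup

/-- The coordinates of `ℓ^p(V, μ)`, in terms of the conjugate exponent `q` of `p`. -/
noncomputable def coordinateSystemConj (μ : V → 𝕜ˣ) {q : ℝ} (hp : p ≠ ∞)
    (hpq : p.toReal.HolderConjugate q) : CoordinateSystem μ (WeightedLp μ p) :=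
  coordinateSystem hp (fun S => (∑' u : S, (‖(μ u : 𝕜)‖ₑ ^ q)⁻¹) ^ (1 / q))
    (enorm_sum_le_rpow hp hpq) (exists_of_lt_rpow hpq)

end WeightedLp

/-! ### The space `c_0(V, μ)`. -/

namespace WeightedC0

variable {μ}

open Classical in
/-- The unit vector `e_v` of `c_0(V, μ)`. -/
noncomputable def unit (μ : V → 𝕜ˣ) (v : V) : WeightedC0 μ :=
  ⟨Pi.single v 1, fun ε hε => ⟨{v}, fun u hu => by
    rw [Pi.single_eq_of_ne (by simpa using hu)]
    simpa using hε⟩⟩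

/-- The inclusion of `c_0(V, μ)` into `𝕜^V`. -/
def coordMap (μ : V → 𝕜ˣ) : WeightedC0 μ →ₗ[𝕜] (V → 𝕜) := (c0Submodule μ).subtype

theorem norm_apply_mul_le (x : WeightedC0 μ) (v : V) : ‖x v * (μ v : 𝕜)‖ ≤ ‖x‖ :=
  lp.norm_apply_le_norm ENNReal.top_ne_zero (toLp μ x) v

theorem norm_le {x : WeightedC0 μ} {C : ℝ} (hC : 0 ≤ C) (h : ∀ v, ‖x v * (μ v : 𝕜)‖ ≤ C) :
    ‖x‖ ≤ C :=
  lp.norm_le_of_forall_le (f := toLp μ x) hC h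

open Classical in
theorem sum_smul_unit_apply (T : Finset V) (c : V → 𝕜) (v : V) :
    (∑ u ∈ T, c u • unit μ u : WeightedC0 μ) v = if v ∈ T then c v else 0 := by
  change coordMap μ (∑ u ∈ T, c u • unit μ u) v = _
  have h : ∀ u, coordMap μ (unit μ u) = Pi.single u 1 := fun _ => rfl
  simp only [map_sum, map_smul]
  simp [h, Pi.single_apply]

theorem enorm_sum_le (S : Set V) (T : Finset V) (hT : ↑T ⊆ S) (x : WeightedC0 μ) :
    ‖∑ u ∈ T, x u‖ₑ ≤ (∑' u : S, ‖(μ u : 𝕜)‖ₑ⁻¹) * ‖x‖ₑ := by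
  refine (_root_.enorm_sum_le _ _).trans (le_trans ?_
    (mul_le_mul_left (sum_le_tsum_subtype S (fun u => ‖(μ u : 𝕜)‖ₑ⁻¹) hT) _))
  rw [Finset.sum_mul]
  refine Finset.sum_le_sum fun u _ => ?_
  rw [enorm_eq_mul_inv μ (x u) u, mul_comm]
  refine mul_le_mul_right ?_ _
  rw [← ofReal_norm, ← ofReal_norm]
  exact ENNReal.ofReal_le_ofReal (norm_apply_mul_le x u)

theorem exists_of_lt_tsum (S : Set V) (a : ℝ≥0∞) (h : a < ∑' u : S, ‖(μ u : 𝕜)‖ₑ⁻¹) :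
    ∃ T : Finset V, ↑T ⊆ S ∧ ∃ c : V → 𝕜, ∑ u ∈ T, c u = 1 ∧
      a * ‖∑ u ∈ T, c u • unit μ u‖ₑ < 1 := by
  classical
  obtain ⟨T, hTS, hT⟩ := exists_finset_lt_sum S (fun u => ‖(μ u : 𝕜)‖ₑ⁻¹) h
  have hr : ∀ u, 0 < ‖(μ u : 𝕜)‖⁻¹ := fun u => inv_pos.2 (norm_unit_pos μ u)
  have hofReal : ∑ u ∈ T, ‖(μ u : 𝕜)‖ₑ⁻¹ = ENNReal.ofReal (∑ u ∈ T, ‖(μ u : 𝕜)‖⁻¹) := by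
    rw [ENNReal.ofReal_sum_of_nonneg fun u _ => (hr u).le]
    refine Finset.sum_congr rfl fun u _ => ?_
    rw [ENNReal.ofReal_inv_of_pos (norm_unit_pos μ u), ofReal_norm]
  rw [hofReal] at hT
  obtain ⟨R, hR⟩ : ∃ R, R = ∑ u ∈ T, ‖(μ u : 𝕜)‖⁻¹ := ⟨_, rfl⟩
  rw [← hR] at hT
  have hR0 : 0 < R := ENNReal.ofReal_pos.1 (zero_le.trans_lt hT)
  -- With these coefficients `|c_u μ_u|` equals `1/R` at every vertex of `T`.
  refine ⟨T, hTS, fun u => ((‖(μ u : 𝕜)‖⁻¹ / R : ℝ) : 𝕜), ?_, mul_enorm_lt_one hR0 hT ?_⟩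
  · rw [← RCLike.ofReal_sum, ← Finset.sum_div, ← hR, div_self hR0.ne', RCLike.ofReal_one]
  · refine norm_le (by positivity) fun v => ?_
    rw [sum_smul_unit_apply]
    split_ifs
    · rw [norm_mul, RCLike.norm_ofReal, abs_of_pos (div_pos (hr v) hR0), div_mul_eq_mul_div,
        inv_mul_cancel₀ (norm_unit_pos μ v).ne', one_div]
    · simpa using hR0.le

/-- The coordinates of `c_0(V, μ)`. -/
noncomputable def coordinateSystem (μ : V → 𝕜ˣ) : CoordinateSystem μ (WeightedC0 μ) where
  coord := coordMap μ
  coord_injective := Subtype.val_injective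
  basis := unit μ
  coord_basis _ := rfl
  norm_basis v := by
    classical
    have h : ∀ u, (unit μ v) u = Pi.single (M := fun _ => 𝕜) v 1 u := fun _ => rfl
    refine le_antisymm (norm_le (norm_nonneg _) fun u => ?_) ?_
    · rw [h]
      by_cases huv : u = v
      · subst huv
        simp
      · simp [huv]
    · have := norm_apply_mul_le (unit μ v) v
      rwa [h, Pi.single_eq_same, one_mul] at this
  norm_coord_mul_le x v := by
    rw [← norm_mul]
    exact norm_apply_mul_le x v
  approx x ε hε := by
    classical
    obtain ⟨T, hT⟩ := x.2 (ε / 2) (by positivity)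
    refine ⟨T, (norm_le (C := ε / 2) (by positivity) fun v => ?_).trans_lt (by linarith)⟩
    have : (x - ∑ v ∈ T, x v • unit μ v : WeightedC0 μ) v =
        x v - (∑ v ∈ T, x v • unit μ v : WeightedC0 μ) v := rfl
    refine (congrArg (fun a : 𝕜 => ‖a * (μ v : 𝕜)‖) this).trans_le ?_
    rw [sum_smul_unit_apply]
    split_ifs with hv
    · simpa using (half_pos hε).le
    · rw [sub_zero]
      exact (hT v hv).le
  dual S := ∑' u : S, ‖(μ u : 𝕜)‖ₑ⁻¹
  enorm_sum_coord_le := enorm_sum_le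
  exists_of_lt_dual := exists_of_lt_tsum

end WeightedC0

/-! ### Comparing `largeSet` with the explicit conditions. -/

section Conditions

variable {μ} {G : Digraph V} {X : Type*} [NormedAddCommGroup X] [NormedSpace 𝕜 X]
  (s : CoordinateSystem μ X) (hG : IsUnrooted G)

theorem natCast_le_two_mul (N : ℕ) : (N : ℝ≥0∞) ≤ ((2 * N : ℕ) : ℝ≥0∞) := by
  exact_mod_cast (by omega : N ≤ 2 * N)

theorem lt_or_lt_of_two_mul_lt_add {N : ℕ} {a b : ℝ≥0∞} (h : ((2 * N : ℕ) : ℝ≥0∞) < a + b) :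
    (N : ℝ≥0∞) < a ∨ (N : ℝ≥0∞) < b := by
  by_contra! hcon
  refine absurd h (not_lt.2 ?_)
  rw [two_mul, Nat.cast_add]
  exact add_le_add hcon.1 hcon.2

theorem largeSet_subset_one (hs : ∀ S, s.dual S = ⨆ u : S, ‖(μ u : 𝕜)‖ₑ⁻¹) (F : Finset V) (N : ℕ) :
    s.largeSet hG F N ⊆ setIOne G μ F N ∩ setJOne hG μ F N := by
  intro n hn
  simp only [setIOne, setJOne, Set.mem_inter_iff, Set.mem_iInter, Set.mem_ofPred_eq]
  refine ⟨fun v hv => hs _ ▸ (hn v hv).1, fun v hv => min_lt_iff.2 ?_⟩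
  refine (hn v hv).2.imp ENNReal.lt_inv_iff_lt_inv.1 fun h => ?_
  rw [hs] at h
  obtain ⟨u, hu⟩ := lt_iSup_iff.1 h
  exact iInf_lt_iff.2 ⟨u, ENNReal.lt_inv_iff_lt_inv.1 hu⟩

theorem one_subset_largeSet (hs : ∀ S, s.dual S = ⨆ u : S, ‖(μ u : 𝕜)‖ₑ⁻¹) (F : Finset V) (N : ℕ) :
    setIOne G μ F (2 * N) ∩ setJOne hG μ F (2 * N) ⊆ s.largeSet hG F N := by
  intro n hn
  simp only [setIOne, setJOne, Set.mem_inter_iff, Set.mem_iInter, Set.mem_ofPred_eq] at hn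
  have hN := natCast_le_two_mul N
  intro v hv
  refine ⟨hN.trans_lt ((hn.1 v hv).trans_eq (hs _).symm), ?_⟩
  refine (min_lt_iff.1 (hn.2 v hv)).imp
    (fun h => hN.trans_lt (ENNReal.lt_inv_iff_lt_inv.1 h)) fun h => ?_
  obtain ⟨u, hu⟩ := iInf_lt_iff.1 h
  rw [hs]
  exact hN.trans_lt (lt_iSup_iff.2 ⟨u, ENNReal.lt_inv_iff_lt_inv.1 hu⟩)

theorem largeSet_subset_conj {q : ℝ} (hq : 1 < q)
    (hs : ∀ S, s.dual S = (∑' u : S, (‖(μ u : 𝕜)‖ₑ ^ q)⁻¹) ^ (1 / q)) (F : Finset V) (N : ℕ) :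
    s.largeSet hG F N ⊆ setIConj G μ q F N ∩ setJConj hG μ q F N := by
  have hq0 : 0 < q := by linarith
  intro n hn
  simp only [setIConj, setJConj, Set.mem_inter_iff, Set.mem_iInter, Set.mem_ofPred_eq]
  refine ⟨fun v hv => hs _ ▸ (hn v hv).1, fun v hv => ?_⟩
  rcases (hn v hv).2 with h | h
  · refine lt_of_lt_of_le ?_ le_self_add
    rw [← ENNReal.inv_rpow]
    exact ENNReal.rpow_lt_rpow h hq0
  · rw [hs, one_div, ENNReal.lt_rpow_inv_iff hq0] at h
    exact h.trans_le le_add_self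

theorem conj_subset_largeSet {q : ℝ} (hq : 1 < q)
    (hs : ∀ S, s.dual S = (∑' u : S, (‖(μ u : 𝕜)‖ₑ ^ q)⁻¹) ^ (1 / q)) (F : Finset V) (N : ℕ) :
    setIConj G μ q F (2 * N) ∩ setJConj hG μ q F (2 * N) ⊆ s.largeSet hG F N := by
  have hq0 : 0 < q := by linarith
  intro n hn
  simp only [setIConj, setJConj, Set.mem_inter_iff, Set.mem_iInter, Set.mem_ofPred_eq] at hn
  intro v hv
  refine ⟨(natCast_le_two_mul N).trans_lt ((hn.1 v hv).trans_eq (hs _).symm), ?_⟩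
  by_contra! hcon
  refine absurd (hn.2 v hv) (not_lt.2 ?_)
  rw [hs, one_div, ENNReal.rpow_inv_le_iff hq0] at hcon
  rw [← ENNReal.inv_rpow]
  -- If both terms are at most `N^q`, their sum is at most `2 N^q ≤ (2N)^q`, because `q ≥ 1`.
  refine (add_le_add (ENNReal.rpow_le_rpow hcon.1 hq0.le) hcon.2).trans ?_
  rw [Nat.cast_mul, ENNReal.mul_rpow_of_nonneg _ _ hq0.le, ← two_mul]
  refine mul_le_mul_left ?_ _
  simpa using ENNReal.rpow_le_rpow_of_exponent_le (x := 2) (by norm_num) hq.le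

theorem largeSet_subset_c0 (hs : ∀ S, s.dual S = ∑' u : S, ‖(μ u : 𝕜)‖ₑ⁻¹) (F : Finset V) (N : ℕ) :
    s.largeSet hG F N ⊆ setIC0 G μ F N ∩ setJC0 hG μ F N := by
  intro n hn
  simp only [setIC0, setJC0, Set.mem_inter_iff, Set.mem_iInter, Set.mem_ofPred_eq, ← hs]
  exact ⟨fun v hv => (hn v hv).1, fun v hv => (hn v hv).2.elim
    (fun h => h.trans_le le_self_add) (fun h => h.trans_le le_add_self)⟩

theorem c0_subset_largeSet (hs : ∀ S, s.dual S = ∑' u : S, ‖(μ u : 𝕜)‖ₑ⁻¹) (F : Finset V) (N : ℕ) :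
    setIC0 G μ F (2 * N) ∩ setJC0 hG μ F (2 * N) ⊆ s.largeSet hG F N := by
  intro n hn
  simp only [setIC0, setJC0, Set.mem_inter_iff, Set.mem_iInter, Set.mem_ofPred_eq, ← hs] at hn
  exact fun v hv => ⟨(natCast_le_two_mul N).trans_lt (hn.1 v hv),
    lt_or_lt_of_two_mul_lt_add (hn.2 v hv)⟩

end Conditions

end TreeShift

/-! ### The theorem for each of the three kinds of space. -/

theorem mainTheorem1 {V 𝕜 : Type*} [RCLike 𝕜] (G : Digraph V) (hT : IsDirectedTree G)
    (hG : IsUnrooted G) (μ : V → 𝕜ˣ) (𝓕 : Set (Set ℕ)) (h𝓕 : IsFurstenberg 𝓕) :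
    -- the spaces `ℓ^p(V, μ)`, `1 ≤ p < ∞`
    (∀ (p : ℝ≥0∞) [Fact (1 ≤ p)], p ≠ ∞ →
      ∀ B : WeightedLp μ p →L[𝕜] WeightedLp μ p, (∀ f : WeightedLp μ p, IsBackwardShift G f (B f)) →
        List.TFAE
          [ IsTransitive (tildeFamily 𝓕) B,
            IsTransitive 𝓕 B,
            ∀ N : ℕ, 0 < N → ∀ F : Finset V, setILp G μ p F N ∩ setJLp hG μ p F N ∈ 𝓕 ] ∧
        ((∀ A ∈ 𝓕, ∀ n : ℕ, A ∩ Set.Ici n ∈ 𝓕) →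
          List.TFAE
            [ IsTransitive (tildeFamily 𝓕) B,
              IsTransitive 𝓕 B,
              ∀ N : ℕ, 0 < N → ∀ F : Finset V, setILp G μ p F N ∩ setJLp hG μ p F N ∈ 𝓕,
              IsTopRecurrent 𝓕 B ])) ∧
    -- the space `c_0(V, μ)`
    (∀ B : WeightedC0 μ →L[𝕜] WeightedC0 μ, (∀ f : WeightedC0 μ, IsBackwardShift G f (B f)) →
        List.TFAE
          [ IsTransitive (tildeFamily 𝓕) B,
            IsTransitive 𝓕 B,
            ∀ N : ℕ, 0 < N → ∀ F : Finset V, setIC0 G μ F N ∩ setJC0 hG μ F N ∈ 𝓕 ] ∧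
        ((∀ A ∈ 𝓕, ∀ n : ℕ, A ∩ Set.Ici n ∈ 𝓕) →
          List.TFAE
            [ IsTransitive (tildeFamily 𝓕) B,
              IsTransitive 𝓕 B,
              ∀ N : ℕ, 0 < N → ∀ F : Finset V, setIC0 G μ F N ∩ setJC0 hG μ F N ∈ 𝓕,
              IsTopRecurrent 𝓕 B ])) := by
  refine ⟨fun p _ hp B hB => ?_, fun B hB => ?_⟩
  · by_cases hp1 : p = 1
    · subst hp1
      refine (WeightedLp.coordinateSystemOne μ).tfae hT hG hB h𝓕
        (fun N F => setILp G μ 1 F N ∩ setJLp hG μ 1 F N) (fun N _ F => ?_) (fun N F => ?_)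
      · rw [setILp, setJLp, if_pos rfl, if_pos rfl]
        exact largeSet_subset_one _ hG (fun _ => rfl) F N
      · rw [setILp, setJLp, if_pos rfl, if_pos rfl]
        exact one_subset_largeSet _ hG (fun _ => rfl) F N
    · have hp' : 1 < p.toReal := by
        rw [← ENNReal.toReal_one, ENNReal.toReal_lt_toReal ENNReal.one_ne_top hp]
        exact lt_of_le_of_ne Fact.out (Ne.symm hp1)
      have hpq := Real.HolderConjugate.conjExponent hp'
      refine (WeightedLp.coordinateSystemConj μ hp hpq).tfae hT hG hB h𝓕
        (fun N F => setILp G μ p F N ∩ setJLp hG μ p F N) (fun N _ F => ?_) (fun N F => ?_)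
      · rw [setILp, setJLp, if_neg hp1, if_neg hp1]
        exact largeSet_subset_conj _ hG hpq.symm.lt (fun _ => rfl) F N
      · rw [setILp, setJLp, if_neg hp1, if_neg hp1]
        exact conj_subset_largeSet _ hG hpq.symm.lt (fun _ => rfl) F N
  · exact (WeightedC0.coordinateSystem μ).tfae hT hG hB h𝓕
      (fun N F => setIC0 G μ F N ∩ setJC0 hG μ F N)
      (fun N _ F => largeSet_subset_c0 _ hG (fun _ => rfl) F N)
      (fun N F => c0_subset_largeSet _ hG (fun _ => rfl) F N)
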